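/- Let $S\subseteq\mathbb{R}^n$ be nonempty and closed, let $m\ge 1$, $I=\{1,\dots,m\}$, $\ell,\beta\ge 0$, and let $F_i=f_i+g_i-h_i$ for $i\in I$, where $f_i,g_i:\mathbb{R}^n\to(-\infty,+\infty]$ and $h_i:\mathbb{R}^n\to\mathbb{R}$ satisfy the following for each $i\in I$. * $f_i$ is finite and locally Lipschitz on some open set containing $S$. * $g_i$ is finite and differentiable with $\ell$-Lipschitz gradient on some open set containing $S$ and all line segments joining points of $S$. * $h_i$ is $\beta$-weakly convex on some open set $O_i$ containing $S$ and all line segments joining points of $S$, that is, $h_i+\frac{\beta}{2}\|\cdot\|^2$ is convex on every line segment contained in $O_i$. (The condition on line segments holds automatically for every open set containing $S$ if $S$ is convex, and whenever the open set is convex.) For $C\subseteq\mathbb{R}^d$ and $x\in C$, let $\widehat N_C(x)=\{v:\limsup_{y\to x,\,y\in C}\langle v,y-x\rangle/\|y-x\|\le 0\}$, and let $N_C(x)$ (the limiting normal cone) be the set of all limits of sequences $v_k\in\widehat N_C(x_k)$ with $x_k\in C$, $x_k\to x$. The limiting subdifferential of $\varphi$ at a point $x$ with $\varphi(x)$ finite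 is $\partial\varphi(x)=\{v:(v,-1)\in N_{\operatorname{epi}\varphi}(x,\varphi(x))\}$, where $\operatorname{epi}\varphi=\{(x,\alpha)\in\mathbb{R}^n\times\mathbb{R}:\alpha\ge\varphi(x)\}$. A point $\bar x\in S$ is called stationary if there is $\lambda\in\mathbb{R}^m_+\setminus\{0\}$ with $$0\in\sum_{i\in I}\lambda_i\bigl(\partial f_i(\bar x)+\nabla g_i(\bar x)-\partial h_i(\bar x)\bigr)+N_S(\bar x).$$ Let $\bar\gamma\in\left(0,\frac{1}{\ell+\beta}\right)$ (with $\frac10=+\infty$), and let $(x^k)_{k\in\mathbb{N}}$ be generated by the proximal subgradient algorithm: $x^0\in S$ and, for every $k\in\mathbb{N}$, with some $u_i^k\in\partial h_i(x^k)$ ($i\in I$) and some $\gamma_k\in(0,\bar\gamma]$, $$x^{k+1}\in\operatorname*{argmin}_{x\in S}\Bigl(\max_{i\in I}\bigl(f_i(x)-f_i(x^k)+\langle\nabla g_i(x^k)-u_i^k,\,x-x^k\rangle\bigr)+\frac{1}{2\gamma_k}\|x-x^k\|^2\Bigr).$$ Then the following hold. 1. For all $i\in I$ and $k\in\mathbb{N}$,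 $F_i(x^{k+1})+\left(\frac{1}{2\gamma_k}-\frac{\ell+\beta}{2}\right)\|x^{k+1}-x^k\|^2\le F_i(x^k)$. 2. If there exists $i\in I$ such that $F_i$ is bounded from below on $S$, then $\sum_{k=0}^{+\infty}\|x^{k+1}-x^k\|^2<+\infty$, and consequently $x^{k+1}-x^k\to 0$. 3. If there exists $i\in I$ such that $\{x\in S:F_i(x)\le F_i(x^0)\}$ is bounded, then $(x^k)_{k\in\mathbb{N}}$ is bounded. 4. If $\liminf_{k\to+\infty}\gamma_k>0$ and there exists $i\in I$ such that $F_i$ is bounded from below on $S$, then every cluster point of $(x^k)_{k\in\mathbb{N}}$ is stationary. -/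

import Mathlib

open Filter Topology
open scoped Pointwise RealInnerProductSpace

namespace PSG

section NormalCones

variable {V : Type*} [NormedAddCommGroup V] [InnerProductSpace ℝ V]

/-- Regular (Fréchet) normal cone: `limsup ⟪v, y - x⟫ / ‖y - x‖ ≤ 0` as `y → x` within `S`;
empty if `x ∉ S`. -/
def frechetNormalCone (S : Set V) (x : V) : Set V :=
  {v | x ∈ S ∧ ∀ ε : ℝ, 0 < ε → ∀ᶠ y in 𝓝[S] x, ⟪v, y - x⟫ ≤ ε * ‖y - x‖}

/-- Limiting (Mordukhovich) normal cone: the outer limit of the regular normal cones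
at points of `S` tending to `x`; empty if `x ∉ S`. -/
def normalCone (S : Set V) (x : V) : Set V :=
  {v | x ∈ S ∧ ∃ (y : ℕ → V) (w : ℕ → V), (∀ k, y k ∈ S) ∧
    (∀ k, w k ∈ frechetNormalCone S (y k)) ∧
    Tendsto y atTop (𝓝 x) ∧ Tendsto w atTop (𝓝 v)}

/-- Epigraph of an extended-real-valued function, in the space `V × ℝ` with its
Euclidean (Hilbert) norm. -/
def epigraph (φ : V → EReal) : Set (WithLp 2 (V × ℝ)) :=
  {p | φ p.fst ≤ (p.snd : EReal)}

/-- Limiting (Mordukhovich) subdifferential of `φ` at `x`, for finite `φ x`. -/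
def limSubdiff (φ : V → EReal) (x : V) : Set V :=
  {v | φ x ≠ ⊥ ∧ φ x ≠ ⊤ ∧
    WithLp.toLp 2 (v, (-1 : ℝ)) ∈ normalCone (epigraph φ) (WithLp.toLp 2 (x, (φ x).toReal))}

/-- The gradient of an extended-real-valued function, for use where it is finite nearby and
differentiable. -/
noncomputable def egradient [CompleteSpace V] (φ : V → EReal) (x : V) : V :=
  gradient (fun y => (φ y).toReal) x

/-- `φ` is finite and locally Lipschitz on an open set containing `S`. -/
def LocLipschitzNear (S : Set V) (φ : V → EReal) : Prop :=
  ∃ O : Set V, IsOpen O ∧ S ⊆ O ∧ (∀ x ∈ O, φ x ≠ ⊥ ∧ φ x ≠ ⊤) ∧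
    LocallyLipschitzOn O (fun x => (φ x).toReal)

/-- `φ` is finite and differentiable with `ℓ`-Lipschitz gradient on an open set that contains `S`
and all line segments between points of `S`. -/
def LipschitzGradientNear [CompleteSpace V] (S : Set V) (ℓ : ℝ) (φ : V → EReal) : Prop :=
  ∃ O : Set V, IsOpen O ∧ S ⊆ O ∧ (∀ x ∈ S, ∀ y ∈ S, segment ℝ x y ⊆ O) ∧
    (∀ x ∈ O, φ x ≠ ⊥ ∧ φ x ≠ ⊤) ∧
    (∀ x ∈ O, DifferentiableAt ℝ (fun y => (φ y).toReal) x) ∧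
    ∀ x ∈ O, ∀ y ∈ O, ‖egradient φ x - egradient φ y‖ ≤ ℓ * ‖x - y‖

/-- `h` is `β`-weakly convex on an open set `O` that contains `S` and all line segments between
points of `S`: `h + (β / 2) ‖·‖ ^ 2` is convex on every line segment contained in `O`
(for convex `O` this is convexity on `O`). -/
def WeaklyConvexNear (S : Set V) (β : ℝ) (h : V → ℝ) : Prop :=
  ∃ O : Set V, IsOpen O ∧ S ⊆ O ∧ (∀ x ∈ S, ∀ y ∈ S, segment ℝ x y ⊆ O) ∧
    ∀ x y : V, segment ℝ x y ⊆ O →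
      ConvexOn ℝ (segment ℝ x y) (fun z => h z + β / 2 * ‖z‖ ^ 2)

end NormalCones

variable {n m : ℕ}

/-- The components `F i = f i + g i - h i` of the objective. -/
noncomputable def objective (f g : Fin m → EuclideanSpace ℝ (Fin n) → EReal)
    (h : Fin m → EuclideanSpace ℝ (Fin n) → ℝ) (i : Fin m) (x : EuclideanSpace ℝ (Fin n)) : EReal :=
  f i x + g i x - (h i x : EReal)

/-- Stationary points of the problem of minimizing `f + g - h` over `S`. -/
def IsStationary (S : Set (EuclideanSpace ℝ (Fin n)))
    (f g : Fin m → EuclideanSpace ℝ (Fin n) → EReal)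
    (h : Fin m → EuclideanSpace ℝ (Fin n) → ℝ) (x : EuclideanSpace ℝ (Fin n)) : Prop :=
  x ∈ S ∧ ∃ lam : Fin m → ℝ, (∀ i, 0 ≤ lam i) ∧ lam ≠ 0 ∧
    (0 : EuclideanSpace ℝ (Fin n)) ∈
      (∑ i, lam i • (limSubdiff (f i) x + {egradient (g i) x}
        - limSubdiff (fun y => (h i y : EReal)) x)) + normalCone S x

/-- The function minimized over `S` in one step from `xk`, with subgradients `u` and
step size `γ`. -/
noncomputable def stepModel (f g : Fin m → EuclideanSpace ℝ (Fin n) → EReal)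
    (xk : EuclideanSpace ℝ (Fin n)) (u : Fin m → EuclideanSpace ℝ (Fin n)) (γ : ℝ)
    (x : EuclideanSpace ℝ (Fin n)) : EReal :=
  (⨆ i, (f i x - f i xk + ((⟪egradient (g i) xk - u i, x - xk⟫ : ℝ) : EReal)))
    + ((1 / (2 * γ) * ‖x - xk‖ ^ 2 : ℝ) : EReal)

/-- `x` is an (infinite) sequence generated by the proximal subgradient algorithm with
chosen subgradients `u k i` and step sizes `γ k ∈ (0, γbar]`. -/
structure IsPSGSequence (S : Set (EuclideanSpace ℝ (Fin n)))
    (f g : Fin m → EuclideanSpace ℝ (Fin n) → EReal)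
    (h : Fin m → EuclideanSpace ℝ (Fin n) → ℝ) (γbar : ℝ)
    (γ : ℕ → ℝ) (u : ℕ → Fin m → EuclideanSpace ℝ (Fin n))
    (x : ℕ → EuclideanSpace ℝ (Fin n)) : Prop where
  init : x 0 ∈ S
  subgrad : ∀ k i, u k i ∈ limSubdiff (fun y => (h i y : EReal)) (x k)
  step_pos : ∀ k, 0 < γ k
  step_le : ∀ k, γ k ≤ γbar
  next_mem : ∀ k, x (k + 1) ∈ S
  next_min : ∀ k, IsMinOn (stepModel f g (x k) (u k) (γ k)) S (x (k + 1))

end PSG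

/-! The first three claims rest on one decrease inequality. The model vanishes at `x k`, so
minimality makes each of its components at `x (k + 1)`, proximal term included, nonpositive. Adding
the descent lemma for `g i` and the inequality that weak convexity gives for the subgradient `u k i`
yields `IsPSGSequence.decrease`. Since `γbar * (ℓ + β) < 1`, the coefficient of the squared step is
bounded below by a positive constant. Telescoping then gives summability, and the iterates stay in
the initial sublevel set.

For the last claim, weak convexity makes the subgradients locally bounded, so they converge along a
further subsequence, with limits that are again subgradients. As the steps tend to zero, the cluster
point minimizes over `S` the limiting model: a maximum of `f i` plus affine terms, plus a quadratic
with zero gradient there. Stationarity is therefore the multiplier rule `exists_multipliers`.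

That rule is proved by penalization, since `f i` is only locally Lipschitz and `S` only closed. The
maximum becomes a log-sum-exp, and each `f i` gets its own variable `y i`, tied to `s ∈ S` by a
quadratic penalty of weight `N`. For large `N` the minimizers lie near the cluster point. Varying
one variable at a time produces a regular normal to one epigraph, or to `S`. The softmax weights
serve as multipliers, and the penalty gradients cancel on summation. Lipschitz bounds and
compactness allow passage to the limit. -/

namespace PSG

/-! ### Epigraph membership in real terms -/

section Epigraph

variable {V : Type*}

theorem toReal_le_of_mem_epigraph {φ : V → EReal} {p : WithLp 2 (V × ℝ)}
    (hp : p ∈ epigraph φ) (h : φ p.fst ≠ ⊥) : (φ p.fst).toReal ≤ p.snd := by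
  have hp : φ p.fst ≤ (p.snd : EReal) := hp
  simpa using EReal.toReal_le_toReal hp h (EReal.coe_ne_top _)

theorem mem_epigraph_of_toReal_le {φ : V → EReal} {p : WithLp 2 (V × ℝ)}
    (h : φ p.fst ≠ ⊤) (hp : (φ p.fst).toReal ≤ p.snd) : p ∈ epigraph φ :=
  (EReal.le_coe_toReal h).trans (EReal.coe_le_coe_iff.2 hp)

end Epigraph

/-! ### Normal cones, weak convexity and the descent lemma -/

section Normals

variable {V : Type*} [NormedAddCommGroup V] [InnerProductSpace ℝ V]

/-- A regular normal makes a non-acute angle with every feasible direction. -/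
theorem inner_nonpos_of_mem_frechetNormalCone {S : Set V} {x v d : V}
    (hv : v ∈ frechetNormalCone S x) (hd : ∀ᶠ s : ℝ in 𝓝[>] 0, x + s • d ∈ S) :
    ⟪v, d⟫ ≤ 0 := by
  have key : ∀ ε : ℝ, 0 < ε → ⟪v, d⟫ ≤ ε * ‖d‖ := by
    intro ε hε
    have h1 : Tendsto (fun s : ℝ => x + s • d) (𝓝[>] 0) (𝓝[S] x) := by
      refine tendsto_nhdsWithin_iff.2 ⟨?_, hd⟩
      have : Tendsto (fun s : ℝ => x + s • d) (𝓝 0) (𝓝 (x + (0 : ℝ) • d)) :=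
        Continuous.tendsto (by fun_prop) 0
      simp only [zero_smul, add_zero] at this
      exact this.mono_left nhdsWithin_le_nhds
    obtain ⟨s, hs, hs0⟩ := ((h1.eventually (hv.2 ε hε)).and self_mem_nhdsWithin).exists
    have hs0 : 0 < s := hs0
    rw [add_sub_cancel_left, inner_smul_right, norm_smul, Real.norm_of_nonneg hs0.le] at hs
    nlinarith
  by_contra! hcon
  -- This `ε` makes `ε * ‖d‖` at most half of `⟪v, d⟫`; the `+ 1` covers `d = 0`.
  have := key (⟪v, d⟫ / (2 * (‖d‖ + 1))) (by positivity)
  have h2 : ⟪v, d⟫ / (2 * (‖d‖ + 1)) * ‖d‖ ≤ ⟪v, d⟫ / 2 := by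
    rw [div_mul_eq_mul_div, div_le_div_iff₀ (by positivity) (by norm_num)]
    nlinarith [norm_nonneg d]
  linarith

theorem smul_mem_frechetNormalCone {S : Set V} {x v : V} {t : ℝ} (ht : 0 < t)
    (hv : v ∈ frechetNormalCone S x) : t • v ∈ frechetNormalCone S x := by
  refine ⟨hv.1, fun ε hε => ?_⟩
  filter_upwards [hv.2 (ε / t) (by positivity)] with y hy
  rw [real_inner_smul_left]
  calc t * ⟪v, y - x⟫ ≤ t * (ε / t * ‖y - x‖) := by gcongr
    _ = ε * ‖y - x‖ := by field_simp

/-- First-order necessary condition for minimizing a differentiable function over a set. -/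
theorem mem_frechetNormalCone_of_isLocalMinOn {S : Set V} {x v : V} {φ : V → ℝ} {φ' : V →L[ℝ] ℝ}
    (hx : x ∈ S) (hmin : ∀ᶠ y in 𝓝[S] x, φ x ≤ φ y) (hφ : HasFDerivAt φ φ' x)
    (hv : ∀ d, φ' d = -⟪v, d⟫) : v ∈ frechetNormalCone S x := by
  refine ⟨hx, fun ε hε => ?_⟩
  have h1 := (hφ.isLittleO.def hε).filter_mono (nhdsWithin_le_nhds (s := S))
  filter_upwards [hmin, h1] with y hy hy1
  rw [hv] at hy1
  have := (le_abs_self _).trans hy1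
  have h2 := (neg_abs_le _).trans' (neg_le_neg hy1)
  linarith

/-- A diagonal argument: the `k`-th limiting normal is replaced by a regular normal at a point of
`S`, both within `1 / (k + 1)`. -/
theorem mem_normalCone_of_tendsto {S : Set V} {x v : V} {y w : ℕ → V} (hx : x ∈ S)
    (hw : ∀ k, w k ∈ normalCone S (y k)) (hy : Tendsto y atTop (𝓝 x))
    (hwv : Tendsto w atTop (𝓝 v)) : v ∈ normalCone S x := by
  have h1 : ∀ k : ℕ, ∃ a b, a ∈ S ∧ b ∈ frechetNormalCone S a ∧
      dist (y k) a < 1 / ((k : ℝ) + 1) ∧ dist (w k) b < 1 / ((k : ℝ) + 1) := by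
    intro k
    obtain ⟨-, a, b, ha, hb, hat, hbt⟩ := hw k
    have hpos : 0 < 1 / ((k : ℝ) + 1) := by positivity
    obtain ⟨j, hj1, hj2⟩ := ((hat.eventually (Metric.ball_mem_nhds _ hpos)).and
      (hbt.eventually (Metric.ball_mem_nhds _ hpos))).exists
    exact ⟨a j, b j, ha j, hb j, by rw [dist_comm]; exact hj1, by rw [dist_comm]; exact hj2⟩
  choose a b ha hb hya hwb using h1
  refine ⟨hx, a, b, ha, hb, ?_, ?_⟩
  · exact (tendsto_iff_of_dist (squeeze_zero (fun _ => dist_nonneg) (fun k => (hya k).le)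
      tendsto_one_div_add_atTop_nhds_zero_nat)).1 hy
  · exact (tendsto_iff_of_dist (squeeze_zero (fun _ => dist_nonneg) (fun k => (hwb k).le)
      tendsto_one_div_add_atTop_nhds_zero_nat)).1 hwv

/-- Regular subgradients of a function with Lipschitz constant `L` near a point are bounded
by `L`. -/
theorem norm_le_of_mem_frechetNormalCone_epigraph {φ : V → EReal} {y w : V} {L : ℝ} (hL0 : 0 ≤ L)
    (hL : ∀ᶠ z in 𝓝 y, φ z ≠ ⊤ ∧ (φ z).toReal ≤ (φ y).toReal + L * ‖z - y‖)
    (hw : WithLp.toLp 2 (w, (-1 : ℝ)) ∈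
      frechetNormalCone (epigraph φ) (WithLp.toLp 2 (y, (φ y).toReal))) : ‖w‖ ≤ L := by
  -- The Lipschitz bound makes `(w, L * ‖w‖)` a feasible direction; testing `(w, -1)` against it
  -- gives `‖w‖ ^ 2 ≤ L * ‖w‖`.
  have h1 : ∀ᶠ s : ℝ in 𝓝[>] 0, (WithLp.toLp 2 (y, (φ y).toReal) : WithLp 2 (V × ℝ))
      + s • WithLp.toLp 2 (w, L * ‖w‖) ∈ epigraph φ := by
    have h2 : Tendsto (fun s : ℝ => y + s • w) (𝓝[>] 0) (𝓝 y) := by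
      have : Tendsto (fun s : ℝ => y + s • w) (𝓝 0) (𝓝 (y + (0 : ℝ) • w)) :=
        Continuous.tendsto (by fun_prop) 0
      simp only [zero_smul, add_zero] at this
      exact this.mono_left nhdsWithin_le_nhds
    filter_upwards [h2.eventually hL, self_mem_nhdsWithin] with s hs (hs0 : 0 < s)
    refine mem_epigraph_of_toReal_le (by simpa using hs.1) ?_
    have := hs.2
    rw [add_sub_cancel_left, norm_smul, Real.norm_of_nonneg hs0.le] at this
    change (φ (y + s • w)).toReal ≤ (φ y).toReal + s * (L * ‖w‖)
    linarith
  have h3 := inner_nonpos_of_mem_frechetNormalCone hw h1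
  rw [WithLp.prod_inner_apply] at h3
  simp only [real_inner_self_eq_norm_sq, RCLike.inner_apply, conj_trivial] at h3
  by_contra! hcon
  nlinarith [norm_nonneg w]

/-- Along a segment from a point of an open set, all nearby base points give segments in the set. -/
theorem eventually_segment_subset {O : Set V} (hO : IsOpen O) {x z : V} (h : segment ℝ x z ⊆ O) :
    ∀ᶠ y in 𝓝 x, segment ℝ y z ⊆ O := by
  have hc : IsCompact (segment ℝ x z) := by
    rw [segment_eq_image_lineMap]
    exact isCompact_Icc.image (AffineMap.lineMap_continuous (R := ℝ))
  obtain ⟨δ, hδ, hsub⟩ := hc.exists_thickening_subset_open hO h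
  filter_upwards [Metric.ball_mem_nhds x hδ] with y hy
  rintro _ ⟨a, b, ha, hb, hab, rfl⟩
  refine hsub (Metric.mem_thickening_iff.2 ⟨a • x + b • z, ⟨a, b, ha, hb, hab, rfl⟩, ?_⟩)
  rw [dist_add_right, dist_smul₀, Real.norm_of_nonneg ha]
  have : dist y x < δ := hy
  nlinarith [dist_nonneg (x := y) (y := x)]

/-- Expanding the square gives the factor `s * (1 - s)`. Weakening it to `s` leaves a bound affine
in `s`, as needed for a feasible direction of the epigraph. -/
theorem weaklyConvex_line {h : V → ℝ} {β : ℝ} (hβ : 0 ≤ β) {y z : V}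
    (hc : ConvexOn ℝ (segment ℝ y z) (fun z => h z + β / 2 * ‖z‖ ^ 2)) {s : ℝ} (hs0 : 0 ≤ s)
    (hs1 : s ≤ 1) :
    h (y + s • (z - y)) ≤ (1 - s) * h y + s * h z + s * (β / 2 * ‖z - y‖ ^ 2) := by
  have h1 := hc.2 (left_mem_segment ℝ y z) (right_mem_segment ℝ y z) (sub_nonneg.2 hs1) hs0
    (by ring)
  have h2 : (1 - s) • y + s • z = y + s • (z - y) := by module
  rw [h2] at h1
  simp only [smul_eq_mul] at h1
  have h3 : ‖y + s • (z - y)‖ ^ 2 = (1 - s) * ‖y‖ ^ 2 + s * ‖z‖ ^ 2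
      - s * (1 - s) * ‖z - y‖ ^ 2 := by
    rw [← h2, norm_add_sq_real, norm_sub_sq_real, norm_smul, norm_smul, real_inner_smul_left,
      real_inner_smul_right, mul_pow, mul_pow, Real.norm_eq_abs, Real.norm_eq_abs, sq_abs, sq_abs,
      real_inner_comm y z]
    ring
  rw [h3] at h1
  have h4 : 0 ≤ s ^ 2 * (β / 2 * ‖z - y‖ ^ 2) := by positivity
  nlinarith

/-- Limiting subgradients of a weakly convex function satisfy the global subgradient inequality
along segments. -/
theorem le_of_mem_limSubdiff_of_weaklyConvex {O : Set V} (hO : IsOpen O) {h : V → ℝ} {β : ℝ}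
    (hβ : 0 ≤ β)
    (hc : ∀ x y : V, segment ℝ x y ⊆ O →
      ConvexOn ℝ (segment ℝ x y) (fun z => h z + β / 2 * ‖z‖ ^ 2))
    {x z u : V} (hxz : segment ℝ x z ⊆ O) (hu : u ∈ limSubdiff (fun y => (h y : EReal)) x) :
    h x + ⟪u, z - x⟫ - β / 2 * ‖z - x‖ ^ 2 ≤ h z := by
  obtain ⟨-, -, -, p, q, hp, hq, hpt, hqt⟩ := hu
  have hp1 : Tendsto (fun k => (p k).fst) atTop (𝓝 x) :=
    ((WithLp.prod_continuous_ofLp 2 V ℝ).fst.tendsto _).comp hpt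
  have hp2 : Tendsto (fun k => (p k).snd) atTop (𝓝 (h x)) :=
    ((WithLp.prod_continuous_ofLp 2 V ℝ).snd.tendsto _).comp hpt
  have hq1 : Tendsto (fun k => (q k).fst) atTop (𝓝 u) :=
    ((WithLp.prod_continuous_ofLp 2 V ℝ).fst.tendsto _).comp hqt
  have hq2 : Tendsto (fun k => (q k).snd) atTop (𝓝 (-1)) :=
    ((WithLp.prod_continuous_ofLp 2 V ℝ).snd.tendsto _).comp hqt
  have hev : ∀ᶠ k in atTop, ⟪(q k).fst, z - (p k).fst⟫
      + (q k).snd * (h z - (p k).snd + β / 2 * ‖z - (p k).fst‖ ^ 2) ≤ 0 := by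
    filter_upwards [hp1.eventually (eventually_segment_subset hO hxz)] with k hk
    have hpk : h (p k).fst ≤ (p k).snd := toReal_le_of_mem_epigraph (hp k) (EReal.coe_ne_bot _)
    -- Weak convexity makes this direction feasible even if `p k` lies strictly above the graph. The
    -- resulting inequality has no local remainder, so it survives the limit in `k`.
    have hd : ∀ᶠ s : ℝ in 𝓝[>] 0, p k + s • WithLp.toLp 2 (z - (p k).fst,
        h z - (p k).snd + β / 2 * ‖z - (p k).fst‖ ^ 2) ∈ epigraph (fun y => (h y : EReal)) := by
      filter_upwards [Ioc_mem_nhdsGT (zero_lt_one' ℝ)] with s hs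
      refine mem_epigraph_of_toReal_le (EReal.coe_ne_top _) ?_
      change h ((p k).fst + s • (z - (p k).fst)) ≤
        (p k).snd + s * (h z - (p k).snd + β / 2 * ‖z - (p k).fst‖ ^ 2)
      have := weaklyConvex_line hβ (hc _ _ hk) hs.1.le hs.2
      nlinarith [hs.2]
    have := inner_nonpos_of_mem_frechetNormalCone (hq k) hd
    rw [WithLp.prod_inner_apply] at this
    simp only [RCLike.inner_apply, conj_trivial] at this
    rw [mul_comm (q k).snd]
    exact this
  have hlim : Tendsto (fun k => ⟪(q k).fst, z - (p k).fst⟫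
      + (q k).snd * (h z - (p k).snd + β / 2 * ‖z - (p k).fst‖ ^ 2)) atTop
      (𝓝 (⟪u, z - x⟫ + (-1) * (h z - h x + β / 2 * ‖z - x‖ ^ 2))) :=
    (hq1.inner (tendsto_const_nhds.sub hp1)).add (hq2.mul ((tendsto_const_nhds.sub hp2).add
      (((tendsto_const_nhds.sub hp1).norm.pow 2).const_mul _)))
  have := le_of_tendsto hlim hev
  linarith

/-- On a ball, `h` is a finite convex function minus a smooth one, and finite-dimensional convex
functions are continuous on open sets. -/
theorem continuousAt_of_weaklyConvex [FiniteDimensional ℝ V] {O : Set V} (hO : IsOpen O)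
    {h : V → ℝ} {β : ℝ}
    (hc : ∀ x y : V, segment ℝ x y ⊆ O →
      ConvexOn ℝ (segment ℝ x y) (fun z => h z + β / 2 * ‖z‖ ^ 2))
    {x : V} (hx : x ∈ O) : ContinuousAt h x := by
  obtain ⟨r, hr, hball⟩ := Metric.isOpen_iff.1 hO x hx
  have hconv : ConvexOn ℝ (Metric.ball x r) (fun z => h z + β / 2 * ‖z‖ ^ 2) := by
    refine ⟨convex_ball x r, fun y hy z hz a b ha hb hab => ?_⟩
    exact (hc y z (((convex_ball x r).segment_subset hy hz).trans hball)).2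
      (left_mem_segment ℝ y z) (right_mem_segment ℝ y z) ha hb hab
  have h1 := (hconv.continuousOn Metric.isOpen_ball).continuousAt (Metric.ball_mem_nhds x hr)
  have h2 : ContinuousAt (fun z => (h z + β / 2 * ‖z‖ ^ 2) - β / 2 * ‖z‖ ^ 2) x :=
    h1.sub (by fun_prop)
  simpa using h2

theorem exists_norm_le_of_mem_limSubdiff [FiniteDimensional ℝ V] {O : Set V} (hO : IsOpen O)
    {h : V → ℝ} {β : ℝ} (hβ : 0 ≤ β)
    (hc : ∀ x y : V, segment ℝ x y ⊆ O →
      ConvexOn ℝ (segment ℝ x y) (fun z => h z + β / 2 * ‖z‖ ^ 2))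
    {x : V} (hx : x ∈ O) :
    ∃ M : ℝ, ∀ᶠ y in 𝓝 x, ∀ u ∈ limSubdiff (fun y => (h y : EReal)) y, ‖u‖ ≤ M := by
  have h1 := continuousAt_of_weaklyConvex hO hc hx
  obtain ⟨r, hr, hball⟩ := Metric.mem_nhds_iff.1
    (inter_mem (hO.mem_nhds hx) (h1 (Metric.ball_mem_nhds (h x) one_pos)))
  -- A move of length `r / 4` along `u` stays in the ball, where two values of `h` differ by less
  -- than `2`. The subgradient inequality then bounds `r / 4 * ‖u‖`.
  refine ⟨(2 + β / 2 * (r / 4) ^ 2) / (r / 4), ?_⟩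
  filter_upwards [Metric.ball_mem_nhds x (half_pos hr)] with y hy u hu
  have hy : dist y x < r / 2 := hy
  by_cases hu0 : u = 0
  · rw [hu0, norm_zero]; positivity
  have hun : 0 < ‖u‖ := norm_pos_iff.2 hu0
  have hzy : ‖(r / 4 * ‖u‖⁻¹) • u‖ = r / 4 := by
    rw [norm_smul, Real.norm_of_nonneg (by positivity)]; field_simp
  have hy' : y ∈ Metric.ball x r := Metric.mem_ball.2 (by linarith)
  have hz : y + (r / 4 * ‖u‖⁻¹) • u ∈ Metric.ball x r := by
    have := dist_triangle (y + (r / 4 * ‖u‖⁻¹) • u) y x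
    rw [dist_eq_norm (y + _) y, add_sub_cancel_left, hzy] at this
    exact Metric.mem_ball.2 (by linarith)
  have h2 := le_of_mem_limSubdiff_of_weaklyConvex hO hβ hc
    (((convex_ball x r).segment_subset hy' hz).trans fun w hw => (hball hw).1) hu
  rw [add_sub_cancel_left, hzy, inner_smul_right, real_inner_self_eq_norm_sq] at h2
  have h3 : r / 4 * ‖u‖⁻¹ * ‖u‖ ^ 2 = r / 4 * ‖u‖ := by field_simp
  rw [h3] at h2
  have h4 : |h y - h x| < 1 := (hball hy').2
  have h5 : |h (y + (r / 4 * ‖u‖⁻¹) • u) - h x| < 1 := (hball hz).2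
  rw [abs_lt] at h4 h5
  rw [le_div_iff₀ (by positivity)]
  nlinarith

/-- Descent lemma on a segment. -/
theorem descent_of_lipschitz_gradient [CompleteSpace V] {O : Set V} {G : V → ℝ} {ℓ : ℝ}
    (hd : ∀ x ∈ O, DifferentiableAt ℝ G x)
    (hL : ∀ x ∈ O, ∀ y ∈ O, ‖gradient G x - gradient G y‖ ≤ ℓ * ‖x - y‖)
    {x y : V} (hxy : segment ℝ x y ⊆ O) :
    G y ≤ G x + ⟪gradient G x, y - x⟫ + ℓ / 2 * ‖y - x‖ ^ 2 := by
  have hmem : ∀ t ∈ Set.Icc (0 : ℝ) 1, x + t • (y - x) ∈ O := by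
    intro t ht
    refine hxy ?_
    rw [segment_eq_image']
    exact ⟨t, ht, rfl⟩
  -- Subtracting the claimed upper model along the segment leaves a function with nonpositive
  -- derivative; its endpoint values give the bound.
  have hder : ∀ t ∈ Set.Icc (0 : ℝ) 1, HasDerivAt
      (fun t : ℝ => G (x + t • (y - x)) - t * ⟪gradient G x, y - x⟫ - ℓ / 2 * ‖y - x‖ ^ 2 * t ^ 2)
      (⟪gradient G (x + t • (y - x)), y - x⟫ - ⟪gradient G x, y - x⟫ - ℓ * ‖y - x‖ ^ 2 * t) t := by
    intro t ht
    have hline : HasDerivAt (fun t : ℝ => x + t • (y - x)) (y - x) t := by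
      simpa using ((hasDerivAt_id t).smul_const (y - x)).const_add x
    have h1 := (hd _ (hmem t ht)).hasGradientAt.hasFDerivAt.comp_hasDerivAt t hline
    refine ((h1.sub ((hasDerivAt_id t).mul_const ⟪gradient G x, y - x⟫)).sub
      (((hasDerivAt_id t).pow 2).const_mul (ℓ / 2 * ‖y - x‖ ^ 2))).congr_deriv ?_
    rw [InnerProductSpace.toDual_apply_apply]
    simp only [id]
    push_cast
    ring
  have hanti : AntitoneOn
      (fun t : ℝ => G (x + t • (y - x)) - t * ⟪gradient G x, y - x⟫ - ℓ / 2 * ‖y - x‖ ^ 2 * t ^ 2)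
      (Set.Icc 0 1) := by
    refine antitoneOn_of_deriv_nonpos (convex_Icc 0 1)
      (fun t ht => (hder t ht).continuousAt.continuousWithinAt)
      (fun t ht => (hder t (interior_subset ht)).differentiableAt.differentiableWithinAt) ?_
    intro t ht
    have ht' := interior_subset ht
    rw [(hder t ht').deriv, ← inner_sub_left]
    have h1 := hL _ (hmem t ht') x (hxy (left_mem_segment ℝ x y))
    rw [add_sub_cancel_left, norm_smul, Real.norm_of_nonneg ht'.1] at h1
    have h2 := real_inner_le_norm (gradient G (x + t • (y - x)) - gradient G x) (y - x)
    have h3 := mul_le_mul_of_nonneg_right h1 (norm_nonneg (y - x))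
    nlinarith
  have := hanti (Set.left_mem_Icc.2 zero_le_one) (Set.right_mem_Icc.2 zero_le_one) zero_le_one
  simp only [one_smul, zero_smul, add_sub_cancel, add_zero, zero_mul, one_mul] at this
  linarith

end Normals

end PSG

namespace PSG

/-! ### Multiplier rule for a finite maximum, by penalization -/

section Multipliers

variable {V ι : Type*} [NormedAddCommGroup V] [InnerProductSpace ℝ V] [Fintype ι]

/-- Smooth decoupled penalization of the problem of minimizing `max i, R i s + κ * ‖s - x‖ ^ 2`:
the maximum is replaced by a log-sum-exp, and each function gets its own copy of the variable. -/
noncomputable def penalized (R : ι → V → ℝ) (x : V) (κ N : ℝ) (y : ι → V) (s : V) : ℝ :=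
  N⁻¹ * Real.log (∑ i, Real.exp (N * R i (y i))) + N * ∑ i, ‖y i - s‖ ^ 2
    + (κ + 1) * ‖s - x‖ ^ 2

theorem le_logSumExp {N : ℝ} (hN : 0 < N) (r : ι → ℝ) (i : ι) :
    r i ≤ N⁻¹ * Real.log (∑ i, Real.exp (N * r i)) := by
  rw [inv_mul_eq_div, le_div_iff₀ hN, mul_comm]
  rw [Real.le_log_iff_exp_le (Finset.sum_pos (fun _ _ => Real.exp_pos _) ⟨i, Finset.mem_univ i⟩)]
  exact Finset.single_le_sum (f := fun i => Real.exp (N * r i))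
    (fun _ _ => (Real.exp_pos _).le) (Finset.mem_univ i)

/-- Minimizers of the penalized problem approach `x` if `x` solves the original problem. -/
theorem penalized_minimizer_bounds [Nonempty ι] {S : Set V} {x : V} {r M κ N : ℝ} (hr : 0 < r)
    (hM : 0 ≤ M) {R : ι → V → ℝ} (hRx : ∀ i, R i x = 0)
    (hR : ∀ i, ∀ y ∈ Metric.closedBall x r, ∀ z ∈ Metric.closedBall x r,
      |R i y - R i z| ≤ M * ‖y - z‖)
    (hmin : ∀ s ∈ S, ∃ i, 0 ≤ R i s + κ * ‖s - x‖ ^ 2) (hN : 1 ≤ N) {y : ι → V} {s : V}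
    (hy : ∀ i, y i ∈ Metric.closedBall x r) (hs : s ∈ S) (hsr : s ∈ Metric.closedBall x r)
    (hκ : 0 ≤ κ)
    (hle : penalized R x κ N y s ≤ penalized R x κ N (fun _ => x) x) :
    (∀ i, ‖y i - s‖ ≤ √((Real.log (Fintype.card ι) + M * r) / N)) ∧
      ‖s - x‖ ^ 2 ≤ Real.log (Fintype.card ι) / N
        + M * √((Real.log (Fintype.card ι) + M * r) / N) := by
  have hN0 : 0 < N := by linarith
  set K := Real.log (Fintype.card ι) with hK
  have hK0 : 0 ≤ K := Real.log_natCast_nonneg _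
  have hKN : K / N ≤ K := div_le_self hK0 hN
  have hval : penalized R x κ N (fun _ => x) x = K / N := by
    simp [penalized, hRx, hK, div_eq_inv_mul]
  rw [hval, penalized] at hle
  have hsoft := le_logSumExp hN0 (fun i => R i (y i))
  have hxr : x ∈ Metric.closedBall x r := Metric.mem_closedBall_self hr.le
  have hlow : ∀ i, -(M * r) ≤ R i (y i) := by
    intro i
    have h1 := hR i _ (hy i) x hxr
    rw [hRx, sub_zero] at h1
    have h2 : ‖y i - x‖ ≤ r := by simpa [dist_eq_norm] using hy i
    have := neg_abs_le (R i (y i))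
    nlinarith
  have hsum0 : 0 ≤ ∑ i, ‖y i - s‖ ^ 2 := Finset.sum_nonneg fun _ _ => by positivity
  have hsx0 : 0 ≤ (κ + 1) * ‖s - x‖ ^ 2 := by positivity
  -- The log-sum-exp is at least `-(M * r)` while the total value is at most `K / N ≤ K`, so the
  -- penalty `N * ‖y i - s‖ ^ 2` is at most `K + M * r`.
  have hδ : ∀ i, ‖y i - s‖ ≤ √((K + M * r) / N) := by
    intro i
    refine Real.le_sqrt_of_sq_le ?_
    rw [le_div_iff₀ hN0]
    have h1 := Finset.single_le_sum (f := fun i => ‖y i - s‖ ^ 2) (fun _ _ => by positivity)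
      (Finset.mem_univ i)
    have h2 := hsoft i
    have h3 := hlow i
    nlinarith
  refine ⟨hδ, ?_⟩
  -- For this `i`, `R i (y i)` is at least `-κ * ‖s - x‖ ^ 2` up to the Lipschitz error. The
  -- coefficient `κ + 1` in `penalized` absorbs this and leaves one `‖s - x‖ ^ 2` to estimate.
  obtain ⟨i, hi⟩ := hmin s hs
  have h1 := hR i _ hsr _ (hy i)
  rw [norm_sub_rev] at h1
  have h2 := (le_abs_self _).trans h1
  have h3 := hsoft i
  have h4 := mul_le_mul_of_nonneg_left (hδ i) hM
  have h5 : 0 ≤ N * ∑ i, ‖y i - s‖ ^ 2 := by positivity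
  nlinarith

/-- A minimizer exists by compactness, and the bounds in `penalized_minimizer_bounds` vanish as `N`
grows. -/
theorem exists_penalized_minimizer [Nonempty ι] [ProperSpace V] {S : Set V} (hS : IsClosed S)
    {x : V} {r M κ : ℝ} (hr : 0 < r)
    (hM : 0 ≤ M) {R : ι → V → ℝ} (hRx : ∀ i, R i x = 0) (hx : x ∈ S)
    (hR : ∀ i, ∀ y ∈ Metric.closedBall x r, ∀ z ∈ Metric.closedBall x r,
      |R i y - R i z| ≤ M * ‖y - z‖) (hκ : 0 ≤ κ)
    (hmin : ∀ s ∈ S, ∃ i, 0 ≤ R i s + κ * ‖s - x‖ ^ 2) {ε : ℝ} (hε : 0 < ε) :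
    ∃ N : ℝ, 0 < N ∧ ∃ (y : ι → V) (s : V), s ∈ S ∧ (∀ i, dist (y i) x < ε) ∧ dist s x < ε ∧
      ∀ (y' : ι → V) (s' : V), (∀ i, y' i ∈ Metric.closedBall x r) → s' ∈ S →
        s' ∈ Metric.closedBall x r → penalized R x κ N y s ≤ penalized R x κ N y' s' := by
  set K := Real.log (Fintype.card ι) with hK
  have hlim0 : Tendsto (fun N : ℝ => √((K + M * r) / N)) atTop (𝓝 0) := by
    have := (Real.continuous_sqrt.tendsto 0).comp
      (tendsto_const_nhds.div_atTop tendsto_id : Tendsto (fun N : ℝ => (K + M * r) / N) atTop (𝓝 0))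
    simpa [Function.comp_def] using this
  have hlim1 : Tendsto (fun N : ℝ => K / N + M * √((K + M * r) / N)) atTop (𝓝 0) := by
    simpa using (tendsto_const_nhds.div_atTop tendsto_id :
      Tendsto (fun N : ℝ => K / N) atTop (𝓝 0)).add (hlim0.const_mul M)
  obtain ⟨N, hN0, hN1, hN⟩ := ((hlim0.eventually_lt_const (half_pos hε)).and
    ((hlim1.eventually_lt_const (show 0 < (ε / 2) ^ 2 by positivity)).and
      (eventually_ge_atTop 1))).exists
  have hNpos : 0 < N := by linarith
  have hxr : x ∈ Metric.closedBall x r := Metric.mem_closedBall_self hr.le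
  have hcpt : IsCompact ((Set.univ.pi fun _ : ι => Metric.closedBall x r) ×ˢ
      (S ∩ Metric.closedBall x r)) :=
    (isCompact_univ_pi fun _ => isCompact_closedBall x r).prod
      ((isCompact_closedBall x r).inter_left hS)
  have hRc : ∀ i, ContinuousOn (R i) (Metric.closedBall x r) := by
    intro i
    refine LipschitzOnWith.continuousOn (K := M.toNNReal) (LipschitzOnWith.of_dist_le_mul ?_)
    intro y hy z hz
    rw [Real.dist_eq, dist_eq_norm, Real.coe_toNNReal _ hM]
    exact hR i y hy z hz
  have hcont : ContinuousOn (fun p : (ι → V) × V => penalized R x κ N p.1 p.2)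
      ((Set.univ.pi fun _ : ι => Metric.closedBall x r) ×ˢ (S ∩ Metric.closedBall x r)) := by
    have h1 : ∀ i, ContinuousOn (fun p : (ι → V) × V => R i (p.1 i))
        ((Set.univ.pi fun _ : ι => Metric.closedBall x r) ×ˢ (S ∩ Metric.closedBall x r)) :=
      fun i => (hRc i).comp (by fun_prop) fun p hp => hp.1 i (Set.mem_univ i)
    unfold penalized
    refine ((continuousOn_const.mul (ContinuousOn.log (continuousOn_finsetSum _ fun i _ =>
      (continuousOn_const.mul (h1 i)).rexp) fun p _ => ?_)).add ?_).add ?_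
    · exact (Finset.sum_pos (fun _ _ => Real.exp_pos _) Finset.univ_nonempty).ne'
    · fun_prop
    · fun_prop
  obtain ⟨⟨y, s⟩, ⟨hy, hsS, hsr⟩, hmn⟩ := hcpt.exists_isMinOn
    ⟨(fun _ => x, x), fun _ _ => hxr, hx, hxr⟩ hcont
  have hmn' : ∀ (y' : ι → V) (s' : V), (∀ i, y' i ∈ Metric.closedBall x r) → s' ∈ S →
        s' ∈ Metric.closedBall x r → penalized R x κ N y s ≤ penalized R x κ N y' s' :=
    fun y' s' h1 h2 h3 => hmn (a := (y', s')) ⟨fun i _ => h1 i, h2, h3⟩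
  obtain ⟨hb1, hb2⟩ := penalized_minimizer_bounds hr hM hRx hR hmin hN
    (fun i => hy i (Set.mem_univ i)) hsS hsr hκ (hmn' _ _ (fun _ => hxr) hx hxr)
  have hs : ‖s - x‖ < ε / 2 := lt_of_pow_lt_pow_left₀ 2 (by positivity) (hb2.trans_lt hN1)
  refine ⟨N, hNpos, y, s, hsS, fun i => ?_, ?_, hmn'⟩
  · have h1 := (hb1 i).trans_lt hN0
    have h2 := norm_add_le (y i - s) (s - x)
    rw [sub_add_sub_cancel] at h2
    rw [dist_eq_norm]
    linarith
  · rw [dist_eq_norm]; linarith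

/-- Approximate multiplier rule with regular normals at nearby points. -/
theorem exists_approximate_multipliers [Nonempty ι] [ProperSpace V] {S : Set V} (hS : IsClosed S)
    {x : V} {r L κ : ℝ} (hr : 0 < r) (hL : 0 ≤ L) {φ : ι → V → EReal} (c : ι → V) (hx : x ∈ S)
    (hfin : ∀ i, ∀ y ∈ Metric.closedBall x r, φ i y ≠ ⊥ ∧ φ i y ≠ ⊤)
    (hφ : ∀ i, ∀ y ∈ Metric.closedBall x r, ∀ z ∈ Metric.closedBall x r,
      |(φ i y).toReal - (φ i z).toReal| ≤ L * ‖y - z‖) (hκ : 0 ≤ κ)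
    (hmin : ∀ s ∈ S, ∃ i, 0 ≤ (φ i s).toReal - (φ i x).toReal + ⟪c i, s - x⟫ + κ * ‖s - x‖ ^ 2)
    {ε : ℝ} (hε : 0 < ε) :
    ∃ (y : ι → V) (s : V) (lam : ι → ℝ) (w : ι → V),
      (∀ i, dist (y i) x < ε) ∧ dist s x < ε ∧ (∀ i, 0 ≤ lam i) ∧ ∑ i, lam i = 1 ∧
      (∀ i, ‖w i‖ ≤ L) ∧
      (∀ i, WithLp.toLp 2 (w i, (-1 : ℝ)) ∈
        frechetNormalCone (epigraph (φ i)) (WithLp.toLp 2 (y i, (φ i (y i)).toReal))) ∧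
      -(∑ i, lam i • (w i + c i)) - (2 * (κ + 1)) • (s - x) ∈ frechetNormalCone S s := by
  classical
  obtain ⟨C, hC0, hC⟩ : ∃ C : ℝ, 0 ≤ C ∧ ∀ i, ‖c i‖ ≤ C :=
    ⟨∑ i, ‖c i‖, by positivity, fun i => Finset.single_le_sum (f := fun i => ‖c i‖)
      (fun _ _ => norm_nonneg _) (Finset.mem_univ i)⟩
  set R : ι → V → ℝ := fun i y => (φ i y).toReal - (φ i x).toReal + ⟪c i, y - x⟫ with hRdef
  have hR : ∀ i, ∀ y ∈ Metric.closedBall x r, ∀ z ∈ Metric.closedBall x r,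
      |R i y - R i z| ≤ (L + C) * ‖y - z‖ := by
    intro i y hy z hz
    have h1 : R i y - R i z = ((φ i y).toReal - (φ i z).toReal) + ⟪c i, y - z⟫ := by
      have : y - z = (y - x) - (z - x) := by abel
      rw [this, inner_sub_right (c i) (y - x)]
      simp only [hRdef]
      ring
    rw [h1, add_mul]
    refine (abs_add_le _ _).trans (add_le_add (hφ i y hy z hz) ?_)
    exact (abs_real_inner_le_norm _ _).trans (mul_le_mul_of_nonneg_right (hC i) (norm_nonneg _))
  -- Closeness below `r` puts the minimizer in the open balls, so only the constraint `s ∈ S`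
  -- remains active.
  obtain ⟨N, hN, y, s, hsS, hyε, hsε, hopt⟩ := exists_penalized_minimizer hS hr
    (add_nonneg hL hC0) (R := R) (fun i => by simp [hRdef]) hx hR hκ hmin (lt_min hε hr)
  have hyr : ∀ i, y i ∈ Metric.ball x r := fun i => (hyε i).trans_le (min_le_right _ _)
  have hsr : s ∈ Metric.ball x r := hsε.trans_le (min_le_right _ _)
  have hyr' : ∀ i, y i ∈ Metric.closedBall x r := fun i => Metric.ball_subset_closedBall (hyr i)
  set Z : ℝ := ∑ i, Real.exp (N * R i (y i)) with hZ
  have hZ0 : 0 < Z := Finset.sum_pos (fun _ _ => Real.exp_pos _) Finset.univ_nonempty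
  -- The partial derivatives of the log-sum-exp; being positive, they may be divided by.
  set lam : ι → ℝ := fun i => Real.exp (N * R i (y i)) / Z with hlam
  have hlam0 : ∀ i, 0 < lam i := fun i => div_pos (Real.exp_pos _) hZ0
  -- Forced by stationarity in `y i`: `lam i • (w i + c i) + (2 * N) • (y i - s) = 0`.
  set w : ι → V := fun i => (lam i)⁻¹ • -(lam i • c i + (2 * N) • (y i - s)) with hw
  have hwc : ∀ i, lam i • (w i + c i) = (2 * N) • (s - y i) := by
    intro i
    rw [smul_add, hw]
    simp only
    rw [smul_inv_smul₀ (hlam0 i).ne']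
    module
  have hnormal : ∀ i, WithLp.toLp 2 (w i, (-1 : ℝ)) ∈
        frechetNormalCone (epigraph (φ i)) (WithLp.toLp 2 (y i, (φ i (y i)).toReal)) := by
    intro i
    have hsc : (WithLp.toLp 2 (w i, (-1 : ℝ)) : WithLp 2 (V × ℝ)) =
        (lam i)⁻¹ • WithLp.toLp 2 (-(lam i • c i + (2 * N) • (y i - s)), -lam i) := by
      rw [← WithLp.toLp_smul, Prod.smul_mk, smul_eq_mul, mul_neg, inv_mul_cancel₀ (hlam0 i).ne']
    rw [hsc]
    refine smul_mem_frechetNormalCone (inv_pos.2 (hlam0 i)) ?_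
    set A : ℝ := ∑ l ∈ Finset.univ.erase i, Real.exp (N * R l (y l)) with hA
    have hA0 : 0 ≤ A := Finset.sum_nonneg fun _ _ => (Real.exp_pos _).le
    -- Replacing the value of `φ i` by the height `p.snd` gives a differentiable function. By
    -- monotonicity of the log-sum-exp, it is locally minimal over the epigraph at the graph point.
    set ψ : WithLp 2 (V × ℝ) → ℝ := fun p =>
      N⁻¹ * Real.log (A + Real.exp (N * (p.snd - (φ i x).toReal + ⟪c i, p.fst - x⟫)))
        + N * ‖p.fst - s‖ ^ 2 with hψ
    have hAZ : A + Real.exp (N * R i (y i)) = Z := by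
      rw [hA, hZ]
      exact Finset.sum_erase_add _ _ (Finset.mem_univ i)
    have hpen : ∀ z : V, penalized R x κ N (Function.update y i z) s =
        N⁻¹ * Real.log (A + Real.exp (N * R i z)) + N * ‖z - s‖ ^ 2
          + (N * ∑ l ∈ Finset.univ.erase i, ‖y l - s‖ ^ 2 + (κ + 1) * ‖s - x‖ ^ 2) := by
      intro z
      rw [penalized, ← Finset.sum_erase_add _ _ (Finset.mem_univ i),
        ← Finset.sum_erase_add (a := i) _ _ (Finset.mem_univ i)]
      have e1 : ∑ l ∈ Finset.univ.erase i, Real.exp (N * R l (Function.update y i z l)) = A :=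
        Finset.sum_congr rfl fun l hl => by
          rw [Function.update_of_ne (Finset.ne_of_mem_erase hl)]
      have e2 : ∑ l ∈ Finset.univ.erase i, ‖Function.update y i z l - s‖ ^ 2 =
          ∑ l ∈ Finset.univ.erase i, ‖y l - s‖ ^ 2 :=
        Finset.sum_congr rfl fun l hl => by
          rw [Function.update_of_ne (Finset.ne_of_mem_erase hl)]
      rw [e1, e2, Function.update_self]
      ring
    have hfst : Tendsto (fun p : WithLp 2 (V × ℝ) => p.fst)
        (𝓝 (WithLp.toLp 2 (y i, (φ i (y i)).toReal))) (𝓝 (y i)) :=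
      (WithLp.prod_continuous_ofLp 2 V ℝ).fst.tendsto _
    refine mem_frechetNormalCone_of_isLocalMinOn (φ := ψ)
      (φ' := N⁻¹ • (Z⁻¹ • (Real.exp (N * R i (y i)) • (N • (WithLp.sndL 2 ℝ V ℝ
          + (innerSL ℝ (c i)).comp (WithLp.fstL 2 ℝ V ℝ)))))
        + N • (2 • (innerSL ℝ (y i - s)).comp (WithLp.fstL 2 ℝ V ℝ))) ?_ ?_ ?_ ?_
    · exact mem_epigraph_of_toReal_le (hfin i _ (hyr' i)).2 le_rfl
    · filter_upwards [nhdsWithin_le_nhds (hfst.eventually (Metric.isOpen_ball.mem_nhds (hyr i))),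
        self_mem_nhdsWithin] with p hp hpe
      have hp : p.fst ∈ Metric.ball x r := hp
      have hp' := Metric.ball_subset_closedBall hp
      have h1 := hopt (Function.update y i p.fst) s (fun l => by
        by_cases hl : l = i
        · subst hl; rwa [Function.update_self]
        · rw [Function.update_of_ne hl]; exact hyr' l) hsS (Metric.ball_subset_closedBall hsr)
      have h2 := hpen (y i)
      rw [Function.update_eq_self] at h2
      rw [h2, hpen] at h1
      have h3 : R i p.fst ≤ p.snd - (φ i x).toReal + ⟪c i, p.fst - x⟫ := by
        have := toReal_le_of_mem_epigraph hpe (hfin i _ hp').1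
        simp only [hRdef]
        linarith
      have h4 : N⁻¹ * Real.log (A + Real.exp (N * R i p.fst)) ≤
          N⁻¹ * Real.log (A + Real.exp (N * (p.snd - (φ i x).toReal + ⟪c i, p.fst - x⟫))) := by
        have : 0 < A + Real.exp (N * R i p.fst) := by positivity
        gcongr
      change N⁻¹ * Real.log (A + Real.exp (N * R i (y i))) + N * ‖y i - s‖ ^ 2 ≤
        N⁻¹ * Real.log (A + Real.exp (N * (p.snd - (φ i x).toReal + ⟪c i, p.fst - x⟫)))
        + N * ‖p.fst - s‖ ^ 2
      linarith
    · have hd1 : HasFDerivAt (fun p : WithLp 2 (V × ℝ) => p.fst) (WithLp.fstL 2 ℝ V ℝ)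
          (WithLp.toLp 2 (y i, (φ i (y i)).toReal)) := (WithLp.fstL 2 ℝ V ℝ).hasFDerivAt
      have hd2 : HasFDerivAt (fun p : WithLp 2 (V × ℝ) => p.snd) (WithLp.sndL 2 ℝ V ℝ)
          (WithLp.toLp 2 (y i, (φ i (y i)).toReal)) := (WithLp.sndL 2 ℝ V ℝ).hasFDerivAt
      have hd3 := (innerSL ℝ (c i)).hasFDerivAt.comp _ (hd1.sub_const x)
      have hd4 := (((hd2.sub_const (φ i x).toReal).add hd3).const_mul N).exp
      have hd5 := ((hd4.const_add A).log (by
        change A + Real.exp (N * R i (y i)) ≠ 0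
        rw [hAZ]; exact hZ0.ne')).const_mul N⁻¹
      refine (hd5.add ((hd1.sub_const s).norm_sq.const_mul N)).congr_fderiv ?_
      change N⁻¹ • ((A + Real.exp (N * R i (y i)))⁻¹ • (Real.exp (N * R i (y i)) • _)) + _ = _
      rw [hAZ]
      rfl
    · intro d
      rw [WithLp.prod_inner_apply]
      change N⁻¹ * (Z⁻¹ * (Real.exp (N * R i (y i)) * (N * (d.snd + ⟪c i, d.fst⟫))))
        + N * (2 • ⟪y i - s, d.fst⟫) =
        -(⟪-(lam i • c i + (2 * N) • (y i - s)), d.fst⟫ + d.snd * -lam i)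
      rw [inner_neg_left, inner_add_left, real_inner_smul_left, real_inner_smul_left, hlam]
      simp only [nsmul_eq_mul]
      push_cast
      field_simp
      ring
  refine ⟨y, s, lam, w, fun i => (hyε i).trans_le (min_le_left _ _), hsε.trans_le (min_le_left _ _),
    fun i => (hlam0 i).le, ?_, fun i => ?_, hnormal, ?_⟩
  · rw [hlam, ← Finset.sum_div, ← hZ, div_self hZ0.ne']
  · refine norm_le_of_mem_frechetNormalCone_epigraph hL ?_ (hnormal i)
    filter_upwards [Metric.isOpen_ball.mem_nhds (hyr i)] with z hz
    have hz' := Metric.ball_subset_closedBall hz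
    have := (le_abs_self _).trans (hφ i z hz' (y i) (hyr' i))
    exact ⟨(hfin i z hz').2, by linarith⟩
  -- The multiplier sum equals the total penalty force, so the asserted normal is minus the gradient
  -- in `s` of the penalized function.
  · rw [Finset.sum_congr rfl fun i _ => hwc i]
    refine mem_frechetNormalCone_of_isLocalMinOn
      (φ := fun s' => N * ∑ i, ‖y i - s'‖ ^ 2 + (κ + 1) * ‖s' - x‖ ^ 2)
      (φ' := N • ∑ i, 2 • (innerSL ℝ (y i - s)).comp (-ContinuousLinearMap.id ℝ V)
        + (κ + 1) • (2 • (innerSL ℝ (s - x)).comp (ContinuousLinearMap.id ℝ V))) hsS ?_ ?_ ?_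
    · filter_upwards [nhdsWithin_le_nhds (Metric.isOpen_ball.mem_nhds hsr),
        self_mem_nhdsWithin] with s' hs' hs'S
      have := hopt y s' hyr' hs'S (Metric.ball_subset_closedBall hs')
      simp only [penalized] at this
      linarith
    · refine ((HasFDerivAt.fun_sum fun i _ =>
        ((hasFDerivAt_id s).const_sub (y i)).norm_sq).const_mul N).add
        (((hasFDerivAt_id s).sub_const x).norm_sq.const_mul (κ + 1))
    · intro d
      have e1 : ∀ i, (2 • (innerSL ℝ (y i - s)).comp (-ContinuousLinearMap.id ℝ V)) d
          = 2 * ⟪s - y i, d⟫ := by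
        intro i
        change 2 • ⟪y i - s, -d⟫ = 2 * ⟪s - y i, d⟫
        rw [inner_neg_right, ← inner_neg_left, neg_sub, nsmul_eq_mul]
        norm_num
      rw [add_apply, smul_apply,
        sum_apply, Finset.sum_congr rfl fun i _ => e1 i]
      change N • ∑ i, 2 * ⟪s - y i, d⟫ + (κ + 1) * (2 • ⟪s - x, d⟫) = _
      rw [inner_sub_left (-_), inner_neg_left, sum_inner, real_inner_smul_left,
        Finset.sum_congr rfl fun i _ => real_inner_smul_left (s - y i) d (2 * N),
        ← Finset.mul_sum, ← Finset.mul_sum]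
      simp only [nsmul_eq_mul, smul_eq_mul]
      push_cast
      ring

/-- Multiplier rule for minimizing a finite maximum over a closed set. -/
theorem exists_multipliers [Nonempty ι] [ProperSpace V] {S : Set V} (hS : IsClosed S)
    {x : V} {κ : ℝ} {φ : ι → V → EReal} (c : ι → V) (hx : x ∈ S)
    (hφ : ∀ i, LocLipschitzNear S (φ i)) (hκ : 0 ≤ κ)
    (hmin : ∀ s ∈ S, ∃ i, 0 ≤ (φ i s).toReal - (φ i x).toReal + ⟪c i, s - x⟫ + κ * ‖s - x‖ ^ 2) :
    ∃ (lam : ι → ℝ) (w : ι → V), (∀ i, 0 ≤ lam i) ∧ ∑ i, lam i = 1 ∧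
      (∀ i, w i ∈ limSubdiff (φ i) x) ∧ -(∑ i, lam i • (w i + c i)) ∈ normalCone S x := by
  have h1 : ∀ i, ∃ K : ℝ, 0 ≤ K ∧ ∃ t ∈ 𝓝 x, (∀ y ∈ t, φ i y ≠ ⊥ ∧ φ i y ≠ ⊤) ∧
      ∀ y ∈ t, ∀ z ∈ t, |(φ i y).toReal - (φ i z).toReal| ≤ K * ‖y - z‖ := by
    intro i
    obtain ⟨O, hO, hSO, hfin, hlip⟩ := hφ i
    obtain ⟨K, t, ht, hK⟩ := hlip (hSO hx)
    rw [hO.nhdsWithin_eq (hSO hx)] at ht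
    refine ⟨K, K.2, t ∩ O, inter_mem ht (hO.mem_nhds (hSO hx)), fun y hy => hfin y hy.2, ?_⟩
    intro y hy z hz
    have := hK.dist_le_mul y hy.1 z hz.1
    rwa [Real.dist_eq, dist_eq_norm] at this
  choose K hK0 t ht hfin hlip using h1
  obtain ⟨r, hr, hrt⟩ := Metric.nhds_basis_closedBall.mem_iff.1 (iInter_mem.2 ht)
  have hrt' : ∀ i, Metric.closedBall x r ⊆ t i := fun i => hrt.trans (Set.iInter_subset _ i)
  have hKL : ∀ i, K i ≤ ∑ i, K i := fun i =>
    Finset.single_le_sum (fun i _ => hK0 i) (Finset.mem_univ i)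
  have hL0 : 0 ≤ ∑ i, K i := Finset.sum_nonneg fun i _ => hK0 i
  have h2 := fun k : ℕ => exists_approximate_multipliers hS hr hL0 c hx
    (fun i y hy => hfin i y (hrt' i hy)) (fun i y hy z hz => (hlip i y (hrt' i hy) z
      (hrt' i hz)).trans (mul_le_mul_of_nonneg_right (hKL i) (norm_nonneg _))) hκ hmin
    (ε := 1 / ((k : ℝ) + 1)) (by positivity)
  choose y s lam w hy hs hlam0 hlam1 hwL hwn hsn using h2
  have hyx : ∀ i, Tendsto (fun k => y k i) atTop (𝓝 x) := fun i =>
    tendsto_iff_dist_tendsto_zero.2 (squeeze_zero (fun _ => dist_nonneg) (fun k => (hy k i).le)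
      tendsto_one_div_add_atTop_nhds_zero_nat)
  have hsx : Tendsto s atTop (𝓝 x) :=
    tendsto_iff_dist_tendsto_zero.2 (squeeze_zero (fun _ => dist_nonneg) (fun k => (hs k).le)
      tendsto_one_div_add_atTop_nhds_zero_nat)
  -- Weights in `[0, 1]` and the uniform Lipschitz bound on `w k i` give a compact set from which to
  -- extract limits.
  have hbd : ∀ k, (lam k, w k) ∈ (Set.univ.pi fun _ : ι => Set.Icc (0 : ℝ) 1) ×ˢ
      (Set.univ.pi fun _ : ι => Metric.closedBall (0 : V) (∑ i, K i)) := by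
    intro k
    refine ⟨fun i _ => ⟨hlam0 k i, ?_⟩, fun i _ => by simpa using hwL k i⟩
    rw [← hlam1 k]
    exact Finset.single_le_sum (fun i _ => hlam0 k i) (Finset.mem_univ i)
  obtain ⟨⟨lam', w'⟩, -, σ, hσ, hlim⟩ := ((isCompact_univ_pi fun _ => isCompact_Icc).prod
    (isCompact_univ_pi fun _ => isCompact_closedBall (0 : V) _)).tendsto_subseq hbd
  have hl : ∀ i, Tendsto (fun k => lam (σ k) i) atTop (𝓝 (lam' i)) := fun i =>
    (((continuous_apply i).comp continuous_fst).tendsto _).comp hlim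
  have hw : ∀ i, Tendsto (fun k => w (σ k) i) atTop (𝓝 (w' i)) := fun i =>
    (((continuous_apply i).comp continuous_snd).tendsto _).comp hlim
  refine ⟨lam', w', fun i => ge_of_tendsto' (hl i) fun k => hlam0 _ i, ?_, fun i => ?_, ?_⟩
  · refine tendsto_nhds_unique (tendsto_finsetSum _ fun i _ => hl i) ?_
    simp only [hlam1]
    exact tendsto_const_nhds
  · have hxt := hrt' i (Metric.mem_closedBall_self hr.le)
    refine ⟨(hfin i x hxt).1, (hfin i x hxt).2,
      mem_epigraph_of_toReal_le (hfin i x hxt).2 le_rfl, _, _, fun k => (hwn (σ k) i).1,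
      fun k => hwn (σ k) i, ?_, ?_⟩
    · have hφx : ContinuousAt (fun y => (φ i y).toReal) x := by
        have : LipschitzOnWith (K i).toNNReal (fun y => (φ i y).toReal) (t i) := by
          refine LipschitzOnWith.of_dist_le_mul fun y hy z hz => ?_
          rw [Real.dist_eq, dist_eq_norm, Real.coe_toNNReal _ (hK0 i)]
          exact hlip i y hy z hz
        exact this.continuousOn.continuousAt (ht i)
      have hyi := (hyx i).comp hσ.tendsto_atTop
      exact ((WithLp.prod_continuous_toLp 2 V ℝ).tendsto _).comp
        (hyi.prodMk_nhds (hφx.tendsto.comp hyi))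
    · exact ((WithLp.prod_continuous_toLp 2 V ℝ).tendsto _).comp
        ((hw i).prodMk_nhds tendsto_const_nhds)
  -- The quadratic contributes `(2 * (κ + 1)) • (s k - x)`, which vanishes in the limit.
  · refine ⟨hx, _, _, fun k => (hsn (σ k)).1, fun k => hsn (σ k), hsx.comp hσ.tendsto_atTop, ?_⟩
    have h3 := ((tendsto_finsetSum Finset.univ fun i _ =>
      (hl i).smul ((hw i).add_const (c i))).neg).sub
      (((hsx.comp hσ.tendsto_atTop).sub_const x).const_smul (2 * (κ + 1)))
    simpa using h3

end Multipliers

end PSG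

namespace PSG

/-! ### Descent and convergence of the algorithm -/

section Algorithm

variable {n m : ℕ}

theorem objective_eq_coe {f g : Fin m → EuclideanSpace ℝ (Fin n) → EReal}
    (h : Fin m → EuclideanSpace ℝ (Fin n) → ℝ) {i : Fin m} {y : EuclideanSpace ℝ (Fin n)}
    (hf : f i y ≠ ⊥ ∧ f i y ≠ ⊤) (hg : g i y ≠ ⊥ ∧ g i y ≠ ⊤) :
    objective f g h i y = (((f i y).toReal + (g i y).toReal - h i y : ℝ) : EReal) := by
  rw [EReal.coe_sub, EReal.coe_add, EReal.coe_toReal hf.2 hf.1, EReal.coe_toReal hg.2 hg.1]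
  rfl

/-- The comparison of two values of the step model, in real terms. -/
theorem exists_forall_le_of_stepModel_le [Nonempty (Fin m)]
    {f g : Fin m → EuclideanSpace ℝ (Fin n) → EReal} {xk y z : EuclideanSpace ℝ (Fin n)}
    {u : Fin m → EuclideanSpace ℝ (Fin n)} {γ : ℝ}
    (hxk : ∀ i, f i xk ≠ ⊥ ∧ f i xk ≠ ⊤) (hy : ∀ i, f i y ≠ ⊥ ∧ f i y ≠ ⊤)
    (hz : ∀ i, f i z ≠ ⊥ ∧ f i z ≠ ⊤)
    (hle : stepModel f g xk u γ z ≤ stepModel f g xk u γ y) :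
    ∃ j, ∀ i, (f i z).toReal - (f i xk).toReal + ⟪egradient (g i) xk - u i, z - xk⟫
        + 1 / (2 * γ) * ‖z - xk‖ ^ 2
      ≤ (f j y).toReal - (f j xk).toReal + ⟪egradient (g j) xk - u j, y - xk⟫
        + 1 / (2 * γ) * ‖y - xk‖ ^ 2 := by
  have hcoe : ∀ w, (∀ i, f i w ≠ ⊥ ∧ f i w ≠ ⊤) → ∀ i,
      f i w - f i xk + ((⟪egradient (g i) xk - u i, w - xk⟫ : ℝ) : EReal) =
      (((f i w).toReal - (f i xk).toReal + ⟪egradient (g i) xk - u i, w - xk⟫ : ℝ) : EReal) := by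
    intro w hw i
    rw [EReal.coe_add, EReal.coe_sub, EReal.coe_toReal (hw i).2 (hw i).1,
      EReal.coe_toReal (hxk i).2 (hxk i).1]
  simp only [stepModel, hcoe y hy, hcoe z hz] at hle
  -- `j` attains the maximum at `y`, hence dominates every component at `z`.
  obtain ⟨j, hj⟩ := exists_eq_ciSup_of_finite (f := fun i =>
    (((f i y).toReal - (f i xk).toReal + ⟪egradient (g i) xk - u i, y - xk⟫ : ℝ) : EReal))
  refine ⟨j, fun i => ?_⟩
  rw [← hj] at hle
  have h1 := (add_le_add_left (le_iSup (fun i =>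
    (((f i z).toReal - (f i xk).toReal + ⟪egradient (g i) xk - u i, z - xk⟫ : ℝ) : EReal)) i)
    ((1 / (2 * γ) * ‖z - xk‖ ^ 2 : ℝ) : EReal)).trans hle
  exact_mod_cast h1

variable {S : Set (EuclideanSpace ℝ (Fin n))} {f g : Fin m → EuclideanSpace ℝ (Fin n) → EReal}
  {h : Fin m → EuclideanSpace ℝ (Fin n) → ℝ} {ℓ β γbar : ℝ} {γ : ℕ → ℝ}
  {u : ℕ → Fin m → EuclideanSpace ℝ (Fin n)} {x : ℕ → EuclideanSpace ℝ (Fin n)}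

theorem LocLipschitzNear.ne_bot_ne_top {φ : EuclideanSpace ℝ (Fin n) → EReal}
    (hφ : LocLipschitzNear S φ) {y : EuclideanSpace ℝ (Fin n)} (hy : y ∈ S) :
    φ y ≠ ⊥ ∧ φ y ≠ ⊤ := by
  obtain ⟨O, -, hSO, hfin, -⟩ := hφ
  exact hfin y (hSO hy)

theorem LocLipschitzNear.continuousAt {φ : EuclideanSpace ℝ (Fin n) → EReal}
    (hφ : LocLipschitzNear S φ) {y : EuclideanSpace ℝ (Fin n)} (hy : y ∈ S) :
    ContinuousAt (fun z => (φ z).toReal) y := by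
  obtain ⟨O, hO, hSO, -, hlip⟩ := hφ
  exact hlip.continuousOn.continuousAt (hO.mem_nhds (hSO hy))

theorem LipschitzGradientNear.ne_bot_ne_top {φ : EuclideanSpace ℝ (Fin n) → EReal}
    (hφ : LipschitzGradientNear S ℓ φ) {y : EuclideanSpace ℝ (Fin n)} (hy : y ∈ S) :
    φ y ≠ ⊥ ∧ φ y ≠ ⊤ := by
  obtain ⟨O, -, hSO, -, hfin, -⟩ := hφ
  exact hfin y (hSO hy)

theorem LipschitzGradientNear.continuousAt_egradient {φ : EuclideanSpace ℝ (Fin n) → EReal}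
    (hℓ : 0 ≤ ℓ) (hφ : LipschitzGradientNear S ℓ φ) {y : EuclideanSpace ℝ (Fin n)} (hy : y ∈ S) :
    ContinuousAt (egradient φ) y := by
  obtain ⟨O, hO, hSO, -, -, -, hL⟩ := hφ
  have : LipschitzOnWith ℓ.toNNReal (egradient φ) O := by
    refine LipschitzOnWith.of_dist_le_mul fun y hy z hz => ?_
    rw [dist_eq_norm, dist_eq_norm, Real.coe_toNNReal _ hℓ]
    exact hL y hy z hz
  exact this.continuousOn.continuousAt (hO.mem_nhds (hSO hy))

theorem IsPSGSequence.mem (hx : IsPSGSequence S f g h γbar γ u x) : ∀ k, x k ∈ S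
  | 0 => hx.init
  | k + 1 => hx.next_mem k

/-- Sufficient decrease along the algorithm. -/
theorem IsPSGSequence.decrease [Nonempty (Fin m)] (hx : IsPSGSequence S f g h γbar γ u x)
    (hβ : 0 ≤ β) (hf : ∀ i, LocLipschitzNear S (f i)) (hg : ∀ i, LipschitzGradientNear S ℓ (g i))
    (hh : ∀ i, WeaklyConvexNear S β (h i)) (i : Fin m) (k : ℕ) :
    (f i (x (k + 1))).toReal + (g i (x (k + 1))).toReal - h i (x (k + 1))
        + (1 / (2 * γ k) - (ℓ + β) / 2) * ‖x (k + 1) - x k‖ ^ 2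
      ≤ (f i (x k)).toReal + (g i (x k)).toReal - h i (x k) := by
  have hk := hx.mem k
  have hk1 := hx.mem (k + 1)
  obtain ⟨j, hj⟩ := exists_forall_le_of_stepModel_le (fun i => (hf i).ne_bot_ne_top hk)
    (fun i => (hf i).ne_bot_ne_top hk) (fun i => (hf i).ne_bot_ne_top hk1) (hx.next_min k hk)
  have h1 := hj i
  simp only [sub_self, inner_zero_right, norm_zero] at h1
  obtain ⟨O, hO, hSO, hseg, -, hd, hL⟩ := hg i
  have h2 := descent_of_lipschitz_gradient hd hL (hseg _ hk _ hk1)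
  obtain ⟨U, hU, hSU, hsegU, hc⟩ := hh i
  have h3 := le_of_mem_limSubdiff_of_weaklyConvex hU hβ hc (hsegU _ hk _ hk1) (hx.subgrad k i)
  rw [inner_sub_left] at h1
  simp only [egradient] at h1
  linarith

/-- Because `γ k ≤ γbar`, the decrease holds with one positive coefficient `a` for all `k`;
telescoping against the lower bound `c` bounds the partial sums. -/
theorem IsPSGSequence.summable [Nonempty (Fin m)] (hx : IsPSGSequence S f g h γbar γ u x)
    (hβ : 0 ≤ β) (hf : ∀ i, LocLipschitzNear S (f i)) (hg : ∀ i, LipschitzGradientNear S ℓ (g i))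
    (hh : ∀ i, WeaklyConvexNear S β (h i)) (hγbar_pos : 0 < γbar) (hγbar : γbar * (ℓ + β) < 1)
    (hbd : ∃ i, ∃ c : ℝ, ∀ y ∈ S, (c : EReal) ≤ objective f g h i y) :
    Summable fun k => ‖x (k + 1) - x k‖ ^ 2 := by
  obtain ⟨i, c, hc⟩ := hbd
  set F : EuclideanSpace ℝ (Fin n) → ℝ := fun y => (f i y).toReal + (g i y).toReal - h i y
  have hcF : ∀ y ∈ S, c ≤ F y := by
    intro y hy
    have := hc y hy
    rw [objective_eq_coe h ((hf i).ne_bot_ne_top hy) ((hg i).ne_bot_ne_top hy)] at this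
    exact EReal.coe_le_coe_iff.1 this
  set a : ℝ := 1 / (2 * γbar) - (ℓ + β) / 2 with ha
  have ha0 : 0 < a := by
    rw [ha, sub_pos, div_lt_div_iff₀ (by norm_num) (by positivity)]
    linarith
  have hstep : ∀ k, F (x (k + 1)) + a * ‖x (k + 1) - x k‖ ^ 2 ≤ F (x k) := by
    intro k
    have h1 := hx.decrease hβ hf hg hh i k
    have h2 : 1 / (2 * γbar) ≤ 1 / (2 * γ k) :=
      one_div_le_one_div_of_le (by linarith [hx.step_pos k]) (by linarith [hx.step_le k])
    have h3 : a * ‖x (k + 1) - x k‖ ^ 2 ≤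
        (1 / (2 * γ k) - (ℓ + β) / 2) * ‖x (k + 1) - x k‖ ^ 2 :=
      mul_le_mul_of_nonneg_right (by linarith) (by positivity)
    simp only [F]
    linarith
  have hsum : ∀ K, F (x K) + a * ∑ k ∈ Finset.range K, ‖x (k + 1) - x k‖ ^ 2 ≤ F (x 0) := by
    intro K
    induction K with
    | zero => simp
    | succ K ih =>
      rw [Finset.sum_range_succ, mul_add]
      linarith [hstep K]
  refine summable_of_sum_range_le (c := (F (x 0) - c) / a) (fun _ => by positivity) fun K => ?_
  rw [le_div_iff₀ ha0]
  linarith [hsum K, hcF _ (hx.mem K)]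

theorem tendsto_zero_of_summable_norm_sq {d : ℕ → EuclideanSpace ℝ (Fin n)}
    (hd : Summable fun k => ‖d k‖ ^ 2) : Tendsto d atTop (𝓝 0) := by
  rw [tendsto_zero_iff_norm_tendsto_zero]
  simpa [Function.comp_def] using (Real.continuous_sqrt.tendsto 0).comp hd.tendsto_atTop_zero

/-- Subsequential limits of the iterates and subgradients solve the limiting model problem. -/
theorem IsPSGSequence.exists_nonneg_of_tendsto [Nonempty (Fin m)]
    (hx : IsPSGSequence S f g h γbar γ u x) (hℓ : 0 ≤ ℓ) (hf : ∀ i, LocLipschitzNear S (f i))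
    (hg : ∀ i, LipschitzGradientNear S ℓ (g i)) {a : ℝ} (ha : 0 < a)
    (hγ : ∀ᶠ k in atTop, a < γ k) (hdiff : Tendsto (fun k => x (k + 1) - x k) atTop (𝓝 0))
    {ρ : ℕ → ℕ} (hρ : StrictMono ρ) {xbar : EuclideanSpace ℝ (Fin n)} (hxbar : xbar ∈ S)
    (hxρ : Tendsto (x ∘ ρ) atTop (𝓝 xbar)) {ubar : Fin m → EuclideanSpace ℝ (Fin n)}
    (huρ : ∀ i, Tendsto (fun k => u (ρ k) i) atTop (𝓝 (ubar i)))
    {s : EuclideanSpace ℝ (Fin n)} (hs : s ∈ S) :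
    ∃ i, 0 ≤ (f i s).toReal - (f i xbar).toReal + ⟪egradient (g i) xbar - ubar i, s - xbar⟫
      + 1 / (2 * a) * ‖s - xbar‖ ^ 2 := by
  -- If all limiting components were negative at `s`, then at a late iterate `s` would beat `x (ρ k
  -- + 1)` in every component. The maximizing index varies with `k`, so all components are compared
  -- at once.
  by_contra! hneg
  have hdρ := hdiff.comp hρ.tendsto_atTop
  have hxρ1 : Tendsto (fun k => x (ρ k + 1)) atTop (𝓝 xbar) := by
    simpa [Function.comp_def] using hdρ.add hxρ
  have hc : ∀ i, Tendsto (fun k => egradient (g i) (x (ρ k)) - u (ρ k) i) atTop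
      (𝓝 (egradient (g i) xbar - ubar i)) := fun i =>
    ((LipschitzGradientNear.continuousAt_egradient hℓ (hg i) hxbar).tendsto.comp hxρ).sub (huρ i)
  have hfx : ∀ i, Tendsto (fun k => (f i (x (ρ k))).toReal) atTop (𝓝 (f i xbar).toReal) :=
    fun i => ((hf i).continuousAt hxbar).tendsto.comp hxρ
  have hfx1 : ∀ i, Tendsto (fun k => (f i (x (ρ k + 1))).toReal) atTop (𝓝 (f i xbar).toReal) :=
    fun i => ((hf i).continuousAt hxbar).tendsto.comp hxρ1
  have hleft : ∀ i, Tendsto (fun k => (f i (x (ρ k + 1))).toReal - (f i (x (ρ k))).toReal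
      + ⟪egradient (g i) (x (ρ k)) - u (ρ k) i, x (ρ k + 1) - x (ρ k)⟫) atTop (𝓝 0) := by
    intro i
    simpa using ((hfx1 i).sub (hfx i)).add ((hc i).inner hdρ)
  have hright : ∀ i, Tendsto (fun k => (f i s).toReal - (f i (x (ρ k))).toReal
      + ⟪egradient (g i) (x (ρ k)) - u (ρ k) i, s - x (ρ k)⟫
      + 1 / (2 * a) * ‖s - x (ρ k)‖ ^ 2) atTop
      (𝓝 ((f i s).toReal - (f i xbar).toReal + ⟪egradient (g i) xbar - ubar i, s - xbar⟫
      + 1 / (2 * a) * ‖s - xbar‖ ^ 2)) := fun i =>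
    ((tendsto_const_nhds.sub (hfx i)).add ((hc i).inner (tendsto_const_nhds.sub hxρ))).add
      (((tendsto_const_nhds.sub hxρ).norm.pow 2).const_mul _)
  have hev : ∀ᶠ k in atTop, ∀ i, (f i s).toReal - (f i (x (ρ k))).toReal
      + ⟪egradient (g i) (x (ρ k)) - u (ρ k) i, s - x (ρ k)⟫
      + 1 / (2 * a) * ‖s - x (ρ k)‖ ^ 2 <
      (f i (x (ρ k + 1))).toReal - (f i (x (ρ k))).toReal
      + ⟪egradient (g i) (x (ρ k)) - u (ρ k) i, x (ρ k + 1) - x (ρ k)⟫ :=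
    eventually_all.2 fun i => (hright i).eventually_lt (hleft i) (hneg i)
  obtain ⟨k, hk, hka⟩ := (hev.and (hρ.tendsto_atTop.eventually hγ)).exists
  obtain ⟨j, hj⟩ := exists_forall_le_of_stepModel_le
    (fun i => (hf i).ne_bot_ne_top (hx.mem (ρ k))) (fun i => (hf i).ne_bot_ne_top hs)
    (fun i => (hf i).ne_bot_ne_top (hx.mem (ρ k + 1))) (hx.next_min (ρ k) hs)
  have h1 : 1 / (2 * γ (ρ k)) * ‖s - x (ρ k)‖ ^ 2 ≤ 1 / (2 * a) * ‖s - x (ρ k)‖ ^ 2 :=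
    mul_le_mul_of_nonneg_right (one_div_le_one_div_of_le (by linarith) (by linarith))
      (by positivity)
  have h2 : 0 ≤ 1 / (2 * γ (ρ k)) * ‖x (ρ k + 1) - x (ρ k)‖ ^ 2 := by
    have := hx.step_pos (ρ k)
    positivity
  linarith [hj j, hk j]

/-- Convergent iterates have, after passing to a subsequence, convergent subgradients, with limits
that are subgradients at the limit point. -/
theorem IsPSGSequence.exists_subseq (hx : IsPSGSequence S f g h γbar γ u x) (hβ : 0 ≤ β)
    (hh : ∀ i, WeaklyConvexNear S β (h i)) {xbar : EuclideanSpace ℝ (Fin n)} (hxbar : xbar ∈ S)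
    {σ : ℕ → ℕ} (hσ : StrictMono σ) (hxσ : Tendsto (x ∘ σ) atTop (𝓝 xbar)) :
    ∃ (ρ : ℕ → ℕ) (ubar : Fin m → EuclideanSpace ℝ (Fin n)), StrictMono ρ ∧
      Tendsto (x ∘ ρ) atTop (𝓝 xbar) ∧
      (∀ i, Tendsto (fun k => u (ρ k) i) atTop (𝓝 (ubar i))) ∧
      ∀ i, ubar i ∈ limSubdiff (fun y => (h i y : EReal)) xbar := by
  have hbdd : ∀ i, ∃ M : ℝ, ∀ᶠ y in 𝓝 xbar, ∀ v ∈ limSubdiff (fun y => (h i y : EReal)) y,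
      ‖v‖ ≤ M := by
    intro i
    obtain ⟨U, hU, hSU, -, hc⟩ := hh i
    exact exists_norm_le_of_mem_limSubdiff hU hβ hc (hSU hxbar)
  choose M hM using hbdd
  have hev : ∀ᶠ k in atTop, u (σ k) ∈ Set.univ.pi fun i =>
      Metric.closedBall (0 : EuclideanSpace ℝ (Fin n)) (M i) := by
    have : ∀ᶠ k in atTop, ∀ i, ‖u (σ k) i‖ ≤ M i :=
      eventually_all.2 fun i => (hxσ.eventually (hM i)).mono fun k hk => hk _ (hx.subgrad (σ k) i)
    filter_upwards [this] with k hk i _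
    simpa using hk i
  obtain ⟨ubar, -, τ, hτ, hlim⟩ := tendsto_subseq_of_frequently_bounded
    (isCompact_univ_pi fun i => isCompact_closedBall (0 : EuclideanSpace ℝ (Fin n)) (M i)).isBounded
    (x := fun k => u (σ k)) hev.frequently
  have hu : ∀ i, Tendsto (fun k => u (σ (τ k)) i) atTop (𝓝 (ubar i)) := fun i =>
    ((continuous_apply i).tendsto _).comp hlim
  have hxρ := hxσ.comp hτ.tendsto_atTop
  refine ⟨σ ∘ τ, ubar, hσ.comp hτ, hxρ, hu, fun i => ?_⟩
  obtain ⟨U, hU, hSU, -, hc⟩ := hh i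
  -- Continuity of `h i` makes the graph points converge, so the limiting normals to the epigraph
  -- pass to the limit.
  have hcont := continuousAt_of_weaklyConvex hU hc (hSU hxbar)
  refine ⟨EReal.coe_ne_bot _, EReal.coe_ne_top _, mem_normalCone_of_tendsto
    (mem_epigraph_of_toReal_le (EReal.coe_ne_top _) le_rfl)
    (fun k => (hx.subgrad (σ (τ k)) i).2.2) ?_ ?_⟩
  · exact ((WithLp.prod_continuous_toLp 2 _ ℝ).tendsto _).comp
      (hxρ.prodMk_nhds (hcont.tendsto.comp hxρ))
  · exact ((WithLp.prod_continuous_toLp 2 _ ℝ).tendsto _).comp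
      ((hu i).prodMk_nhds tendsto_const_nhds)

/-- The multiplier rule is applied to the limiting model, with linear terms `egradient (g i) xbar -
ubar i` and `κ` from half the liminf of the step sizes. -/
theorem IsPSGSequence.isStationary_of_mapClusterPt [Nonempty (Fin m)]
    (hx : IsPSGSequence S f g h γbar γ u x) (hS : IsClosed S) (hℓ : 0 ≤ ℓ) (hβ : 0 ≤ β)
    (hf : ∀ i, LocLipschitzNear S (f i)) (hg : ∀ i, LipschitzGradientNear S ℓ (g i))
    (hh : ∀ i, WeaklyConvexNear S β (h i)) (hγ : 0 < liminf γ atTop)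
    (hdiff : Tendsto (fun k => x (k + 1) - x k) atTop (𝓝 0))
    {xbar : EuclideanSpace ℝ (Fin n)} (hcl : MapClusterPt xbar atTop x) :
    IsStationary S f g h xbar := by
  obtain ⟨σ, hσ, hxσ⟩ := hcl.tendsto_subseq
  have hxbar : xbar ∈ S := hS.mem_of_tendsto hxσ (Eventually.of_forall fun k => hx.mem _)
  obtain ⟨ρ, ubar, hρ, hxρ, huρ, hubar⟩ := hx.exists_subseq hβ hh hxbar hσ hxσ
  have ha : 0 < liminf γ atTop / 2 := half_pos hγ
  have hγa : ∀ᶠ k in atTop, liminf γ atTop / 2 < γ k :=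
    eventually_lt_of_lt_liminf (half_lt_self hγ)
      (isBoundedUnder_of ⟨0, fun k => (hx.step_pos k).le⟩)
  obtain ⟨lam, w, hlam0, hlam1, hw, hN⟩ := exists_multipliers hS
    (fun i => egradient (g i) xbar - ubar i) hxbar hf
    (κ := 1 / (2 * (liminf γ atTop / 2))) (by positivity)
    (fun s hs => hx.exists_nonneg_of_tendsto hℓ hf hg ha hγa hdiff hρ hxbar hxρ huρ hs)
  refine ⟨hxbar, lam, hlam0, ?_, ?_⟩
  · rintro rfl
    simp at hlam1
  · refine Set.mem_add.2 ⟨_, Set.finsetSum_mem_finsetSum Finset.univ _ _ fun i _ =>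
      Set.smul_mem_smul_set (Set.sub_mem_sub (Set.add_mem_add (hw i) (Set.mem_singleton _))
        (hubar i)), _, hN, ?_⟩
    simp only [add_sub_assoc, add_neg_cancel]

end Algorithm

end PSG

theorem theoremt (n m : ℕ) (hm : 1 ≤ m)
    (S : Set (EuclideanSpace ℝ (Fin n))) (hS : IsClosed S) (hSne : S.Nonempty)
    (f g : Fin m → EuclideanSpace ℝ (Fin n) → EReal)
    (h : Fin m → EuclideanSpace ℝ (Fin n) → ℝ)
    (ℓ β : ℝ) (hℓ : 0 ≤ ℓ) (hβ : 0 ≤ β)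
    (hf_bot : ∀ i x, f i x ≠ ⊥) (hg_bot : ∀ i x, g i x ≠ ⊥)
    (hf : ∀ i, PSG.LocLipschitzNear S (f i))
    (hg : ∀ i, PSG.LipschitzGradientNear S ℓ (g i))
    (hh : ∀ i, PSG.WeaklyConvexNear S β (h i))
    -- `γbar < 1 / (ℓ + β)`, where `1 / 0 = +∞`
    (γbar : ℝ) (hγbar_pos : 0 < γbar) (hγbar : γbar * (ℓ + β) < 1)
    (γ : ℕ → ℝ) (u : ℕ → Fin m → EuclideanSpace ℝ (Fin n))
    (x : ℕ → EuclideanSpace ℝ (Fin n))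
    (hx : PSG.IsPSGSequence S f g h γbar γ u x) :
    (∀ i k, PSG.objective f g h i (x (k + 1))
        + (((1 / (2 * γ k) - (ℓ + β) / 2) * ‖x (k + 1) - x k‖ ^ 2 : ℝ) : EReal)
      ≤ PSG.objective f g h i (x k)) ∧
    ((∃ i, ∃ c : ℝ, ∀ y ∈ S, (c : EReal) ≤ PSG.objective f g h i y) →
      Summable (fun k => ‖x (k + 1) - x k‖ ^ 2) ∧
      Tendsto (fun k => x (k + 1) - x k) atTop (𝓝 0)) ∧
    ((∃ i, Bornology.IsBounded {y ∈ S | PSG.objective f g h i y ≤ PSG.objective f g h i (x 0)}) →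
      Bornology.IsBounded (Set.range x)) ∧
    (0 < liminf γ atTop →
      (∃ i, ∃ c : ℝ, ∀ y ∈ S, (c : EReal) ≤ PSG.objective f g h i y) →
      ∀ xbar, MapClusterPt xbar atTop x → PSG.IsStationary S f g h xbar) := by
  have : Nonempty (Fin m) := ⟨⟨0, hm⟩⟩
  have hdec : ∀ i k, PSG.objective f g h i (x (k + 1))
        + (((1 / (2 * γ k) - (ℓ + β) / 2) * ‖x (k + 1) - x k‖ ^ 2 : ℝ) : EReal)
      ≤ PSG.objective f g h i (x k) := by
    intro i k
    rw [PSG.objective_eq_coe h ((hf i).ne_bot_ne_top (hx.mem _)) ((hg i).ne_bot_ne_top (hx.mem _)),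
      PSG.objective_eq_coe h ((hf i).ne_bot_ne_top (hx.mem _)) ((hg i).ne_bot_ne_top (hx.mem _)),
      ← EReal.coe_add]
    exact EReal.coe_le_coe_iff.2 (hx.decrease hβ hf hg hh i k)
  refine ⟨hdec, fun hbd => ?_, ?_, fun hγ hbd xbar hcl => ?_⟩
  · have := hx.summable hβ hf hg hh hγbar_pos hγbar hbd
    exact ⟨this, PSG.tendsto_zero_of_summable_norm_sq this⟩
  · rintro ⟨i, hi⟩
    refine hi.subset ?_
    have hmono : ∀ k, PSG.objective f g h i (x k) ≤ PSG.objective f g h i (x 0) := by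
      intro k
      induction k with
      | zero => exact le_rfl
      | succ k ih =>
        refine le_trans ?_ ((hdec i k).trans ih)
        refine le_add_of_nonneg_right (EReal.coe_nonneg.2 (mul_nonneg ?_ (by positivity)))
        have h1 := hx.step_pos k
        -- Nonnegativity of the coefficient reduces to `γ k * (ℓ + β) ≤ γbar * (ℓ + β) < 1`.
        rw [sub_nonneg, div_le_div_iff₀ (by norm_num) (by positivity)]
        nlinarith [hx.step_le k, mul_le_mul_of_nonneg_right (hx.step_le k) (add_nonneg hℓ hβ)]
    rintro _ ⟨k, rfl⟩
    exact ⟨hx.mem k, hmono k⟩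
  · have := hx.summable hβ hf hg hh hγbar_pos hγbar hbd
    exact hx.isStationary_of_mapClusterPt hS hℓ hβ hf hg hh hγ
      (PSG.tendsto_zero_of_summable_norm_sq this) hcl
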